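/- **Setting.** Let $\mathcal X\subset\mathbb R^p$ and $\mathcal W\subset\mathbb R$ be compact, let $x_1,\dots,x_N\in\mathcal X$ and $y_1,\dots,y_N\in\mathbb R$, let $\gamma\ge 0$, let $c:\mathbb R\times\mathbb R\to\mathbb R$ be convex in its first argument, and let $k(x,z;w)$ be a real-valued kernel on $\mathbb{R}^p\times\mathbb{R}^p$ with parameter $w$ (for instance a family of reproducing kernels; positive semidefiniteness is not needed). All integrals are with respect to Lebesgue measure on $\mathcal X\times\mathcal W$, and $\|\alpha\|_{L_0}=\int_{\mathcal X\times\mathcal W}\mathbf 1[\alpha(z,w)\ne 0]\,dz\,dw$. The primal problem is $$\text{(PII)}\qquad \min_{\alpha\in L_2(\mathcal X\times\mathcal W)}\ \tfrac12\|\alpha\|_{L_2}^2+\gamma\|\alpha\|_{L_0}\quad\text{subject to}\quad c(\hat y_i,y_i)\le 0,\quad \hat y_i=\int\alpha(z,w)\,k(x_i,z;w)\,dz\,dw,\quad i=1,\dots,N.$$ With the Lagrangian $$\mathcal L(\alpha,\hat y,\lambda,\mu)=\tfrac12\|\alpha\|_{L_2}^2+\gamma\|\alpha\|_{L_0}-\sum_{i}\lambda_i\int\alpha(z,w)k(x_i,z;w)\,dz\,dw+\sum_i\lambda_i\hat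 y_i+\sum_i\mu_i c(\hat y_i,y_i)$$ and the dual function $g(\lambda,\mu)=\inf_{\alpha\in L_2,\ \hat y\in\mathbb R^N}\mathcal L(\alpha,\hat y,\lambda,\mu)\in[-\infty,\infty)$, the dual problem is $$\text{(DII)}\qquad \max_{\lambda\in\mathbb R^N,\ \mu\in\mathbb R^N_+} g(\lambda,\mu).$$ For $\lambda\in\mathbb R^N$ put $\bar\alpha_d(z,w;\lambda)=\sum_{i=1}^N\lambda_i k(x_i,z;w)$, and let $\alpha_d(z,w;\lambda)=\bar\alpha_d(z,w;\lambda)$ if $|\bar\alpha_d(z,w;\lambda)|>\sqrt{2\gamma}$ and $\alpha_d(z,w;\lambda)=0$ otherwise. **Corollary 1.** Assume that for each $i$ the function $(z,w)\mapsto k(x_i,z;w)$ is in $L_2(\mathcal X\times\mathcal W)$ and real analytic on a neighbourhood of $\mathcal X\times\mathcal W$. Let $(\lambda^\star,\mu^\star)$ be a solution of (DII) and, if $\gamma>0$, assume that $|\bar\alpha_d(\cdot,\cdot;\lambda^\star)|$ is not identically equal to $\sqrt{2\gamma}$ on a neighbourhood (in $\mathbb R^p\times\mathbb R$) of any point of $\mathcal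 X\times\mathcal W$. Then $\alpha_d(\cdot,\cdot;\lambda^\star)$ is a solution of (PII), and every solution of (PII) agrees with it almost everywhere on $\mathcal X\times\mathcal W$. Moreover, if $\gamma>0$, the set $\{(z,w)\in\mathcal X\times\mathcal W:\ |\bar\alpha_d(z,w;\lambda^\star)|=\sqrt{2\gamma}\}$ has Lebesgue measure zero. -/

import Mathlib

open MeasureTheory Filter Topology

noncomputable section

/-- The data of a sparse functional program: a compact set `X ⊆ ℝᵖ` of centers, a compact set
`W ⊆ ℝ` of kernel parameters, a parametrized kernel `k x z w = k(x, z; w)`, training pairs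
`(x i, y i)` with `x i ∈ X`, a loss `c` that is convex in the predicted value, and a
regularization factor `γ ≥ 0`. -/
structure SparseProgram (p N : ℕ) where
  X : Set (EuclideanSpace ℝ (Fin p))
  isCompact_X : IsCompact X
  W : Set ℝ
  isCompact_W : IsCompact W
  k : EuclideanSpace ℝ (Fin p) → EuclideanSpace ℝ (Fin p) → ℝ → ℝ
  x : Fin N → EuclideanSpace ℝ (Fin p)
  x_mem : ∀ i, x i ∈ X
  y : Fin N → ℝ
  c : ℝ → ℝ → ℝ
  convex_c : ∀ t : ℝ, ConvexOn ℝ Set.univ (fun s => c s t)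
  γ : ℝ
  γ_nonneg : 0 ≤ γ

namespace SparseProgram

variable {p N : ℕ} (P : SparseProgram p N)

/-- Lebesgue measure `dz dw` on `X × W`. -/
def leb : Measure (EuclideanSpace ℝ (Fin p) × ℝ) := volume.restrict (P.X ×ˢ P.W)

/-- The section `(z, w) ↦ k(xᵢ, z; w)` of the kernel at the `i`-th data point. -/
def kAt (i : Fin N) (q : EuclideanSpace ℝ (Fin p) × ℝ) : ℝ := P.k (P.x i) q.1 q.2

/-- Membership in `L₂(X × W)`. -/
def InL2 (f : EuclideanSpace ℝ (Fin p) × ℝ → ℝ) : Prop := MemLp f 2 P.leb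

/-- The squared `L₂`-norm on `X × W`. -/
def sqNormL2 (α : EuclideanSpace ℝ (Fin p) × ℝ → ℝ) : ℝ := ∫ q, α q ^ 2 ∂P.leb

/-- The "`L₀`-norm" on `X × W`: the integral of the indicator of `α ≠ 0`. -/
def normL0 (α : EuclideanSpace ℝ (Fin p) × ℝ → ℝ) : ℝ :=
  ∫ q, {q' | α q' ≠ 0}.indicator (fun _ => (1 : ℝ)) q ∂P.leb

/-- The primal objective `½ ‖α‖²_{L₂} + γ ‖α‖_{L₀}`. -/
def objective (α : EuclideanSpace ℝ (Fin p) × ℝ → ℝ) : ℝ :=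
  1 / 2 * P.sqNormL2 α + P.γ * P.normL0 α

/-- The prediction `f(xᵢ) = ∫ α(z, w) k(xᵢ, z; w) dz dw`. -/
def prediction (α : EuclideanSpace ℝ (Fin p) × ℝ → ℝ) (i : Fin N) : ℝ :=
  ∫ q, α q * P.kAt i q ∂P.leb

/-- Feasibility in the primal problem: `α ∈ L₂` and `c(f(xᵢ), yᵢ) ≤ 0` for all `i`. -/
def IsFeasible (α : EuclideanSpace ℝ (Fin p) × ℝ → ℝ) : Prop :=
  P.InL2 α ∧ ∀ i, P.c (P.prediction α i) (P.y i) ≤ 0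

/-- `α` solves the primal problem: it is feasible and minimizes the objective among all
feasible functions. -/
def IsPrimalSolution (α : EuclideanSpace ℝ (Fin p) × ℝ → ℝ) : Prop :=
  P.IsFeasible α ∧ ∀ β, P.IsFeasible β → P.objective α ≤ P.objective β

/-- The Lagrangian `ℒ(α, ŷ, λ, μ)`, with `l = λ`, `m = μ`. -/
def lagrangian (α : EuclideanSpace ℝ (Fin p) × ℝ → ℝ) (yhat l m : Fin N → ℝ) : ℝ :=
  P.objective α - ∑ i, l i * P.prediction α i + ∑ i, l i * yhat i
    + ∑ i, m i * P.c (yhat i) (P.y i)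

/-- The dual function `g(λ, μ)`: the infimum of the Lagrangian over `α ∈ L₂` and `ŷ ∈ ℝᴺ`,
which may be `-∞`. -/
def dualFunction (l m : Fin N → ℝ) : EReal :=
  ⨅ (α : {f : EuclideanSpace ℝ (Fin p) × ℝ → ℝ // P.InL2 f}) (yhat : Fin N → ℝ),
    (P.lagrangian α.1 yhat l m : EReal)

/-- `(λ, μ)` solves the dual problem: `μ ≥ 0` and it maximizes the dual function over
`ℝᴺ × ℝᴺ₊`. -/
def IsDualSolution (l m : Fin N → ℝ) : Prop :=
  (∀ i, 0 ≤ m i) ∧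
    ∀ l' m' : Fin N → ℝ, (∀ i, 0 ≤ m' i) → P.dualFunction l' m' ≤ P.dualFunction l m

/-- The unthresholded function `ᾱ_d(z, w; λ) = ∑ᵢ λᵢ k(xᵢ, z; w)`. -/
def alphaBar (l : Fin N → ℝ) (q : EuclideanSpace ℝ (Fin p) × ℝ) : ℝ := ∑ i, l i * P.kAt i q

open Classical in
/-- The thresholded function `α_d(z, w; λ)`. -/
def alphaD (l : Fin N → ℝ) (q : EuclideanSpace ℝ (Fin p) × ℝ) : ℝ :=
  if √(2 * P.γ) < |P.alphaBar l q| then P.alphaBar l q else 0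

end SparseProgram

end

/-!
For fixed multipliers the Lagrangian is minimized over `α` pointwise: the integrand
`½ s² + γ 1[s ≠ 0] - s ᾱ_d(q; λ)` has the hard threshold of `ᾱ_d(q; λ)` as a minimizer in `s`, and
as its only minimizer unless `γ > 0` and `|ᾱ_d(q; λ)| = √(2γ)`. This exceptional set is null,
because `ᾱ_d² - 2γ` is analytic and vanishes identically near no point. Hence, although the
objective is not convex, the predictions of `α_d(·; λ)` are continuous in `λ` at `λ⋆`. Moving from
`(λ⋆, μ⋆)` a distance `ε` towards another multiplier `(λ', μ')` and letting `ε → 0` gives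
`inf_ŷ ℒ(α_d(·; λ⋆), ŷ, λ', μ') ≤ g(λ⋆, μ⋆)`. Taking `(λ', μ') = 0` closes the duality gap, and
perturbing the `i`-th multipliers along a subgradient of `c(·, yᵢ)` shows that `α_d(·; λ⋆)`
satisfies the `i`-th constraint.
-/

section AnalyticZeros

variable {E F : Type*} [NormedAddCommGroup E] [NormedSpace ℝ E]
  [NormedAddCommGroup F] [NormedSpace ℝ F] {f : E → F} {V : Set E} {x : E}

theorem ae_lineMap_ne_zero_of_analyticOnNhd (hV : IsOpen V) (hVc : Convex ℝ V)
    (hf : AnalyticOnNhd ℝ f V) (hx : x ∈ V) (hfx : f x ≠ 0) (v : E) :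
    ∀ᵐ t : ℝ, AffineMap.lineMap x v t ∈ V → f (AffineMap.lineMap x v t) ≠ 0 := by
  let U : Set ℝ := AffineMap.lineMap x v ⁻¹' V
  have hU : IsOpen U := hV.preimage AffineMap.lineMap_continuous
  have hUc : Convex ℝ U := hVc.affine_preimage (AffineMap.lineMap x v)
  have hline : AnalyticOnNhd ℝ (fun t : ℝ => AffineMap.lineMap x v t) U := fun t _ => by
    simp only [AffineMap.lineMap_apply_module']
    fun_prop
  rcases (hf.comp hline fun _ ht => ht).eqOn_zero_or_eventually_ne_zero_of_preconnected
    hUc.isPreconnected with hzero | hne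
  · have h0 : (0 : ℝ) ∈ U := by simpa [U] using hx
    exact absurd (hzero h0) (by simpa using hfx)
  · exact (ae_restrict_iff' hU.measurableSet).1
      (ae_restrict_le_codiscreteWithin hU.measurableSet hne)

variable [FiniteDimensional ℝ E] [MeasurableSpace E] [BorelSpace E]
  (μ : Measure E) [μ.IsAddHaarMeasure]

/- By Fubini some dilation of `Z` about `x` with nonzero ratio is null. -/
theorem addHaar_eq_zero_of_ae_homothety_notMem {Z : Set E} (hZ : MeasurableSet Z) (x : E)
    (hline : ∀ v, ∀ᵐ t : ℝ, AffineMap.homothety x t v ∉ Z) : μ Z = 0 := by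
  have hmeas : Measurable fun q : E × ℝ => AffineMap.homothety x q.2 q.1 := by
    simp only [AffineMap.homothety_apply, vsub_eq_sub, vadd_eq_add]
    fun_prop
  have hswap : ∀ᵐ t : ℝ, ∀ᵐ v ∂μ, AffineMap.homothety x t v ∉ Z :=
    (Measure.ae_ae_comm (hmeas hZ).compl).1 (ae_of_all _ hline)
  obtain ⟨t, ht, ht0⟩ := (hswap.and (Measure.ae_ne volume 0)).exists
  have hsurj : Function.Surjective (AffineMap.homothety x t : E →ᵃ[ℝ] E) :=
    (AffineEquiv.homothetyUnitsMulHom x (Units.mk0 t ht0)).surjective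
  have hpre : μ (AffineMap.homothety x t ⁻¹' Z) = 0 := measure_eq_zero_iff_ae_notMem.2 ht
  rw [← Set.image_preimage_eq Z hsurj, Measure.addHaar_image_homothety, hpre, mul_zero]

theorem addHaar_inter_zeros_eq_zero_of_convex (hV : IsOpen V) (hVc : Convex ℝ V)
    (hf : AnalyticOnNhd ℝ f V) (hx : x ∈ V) (hfx : f x ≠ 0) :
    μ (V ∩ f ⁻¹' {0}) = 0 := by
  have hmeas : MeasurableSet (V ∩ f ⁻¹' {0}) := by
    rw [← Set.sdiff_compl, ← Set.preimage_compl, ← Set.sdiff_self_inter]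
    exact hV.measurableSet.diff
      (hf.continuousOn.isOpen_inter_preimage hV isOpen_compl_singleton).measurableSet
  refine addHaar_eq_zero_of_ae_homothety_notMem μ hmeas x fun v => ?_
  filter_upwards [ae_lineMap_ne_zero_of_analyticOnNhd hV hVc hf hx hfx v] with t ht hZ
  rw [AffineMap.homothety_eq_lineMap] at hZ
  exact ht hZ.1 hZ.2

theorem addHaar_inter_zeros_eq_zero_of_frequently_ne [CompleteSpace F] {s : Set E}
    (hf : AnalyticOnNhd ℝ f s) (hne : ∀ q ∈ s, ∃ᶠ y in 𝓝 q, f y ≠ 0) : μ (s ∩ f ⁻¹' {0}) = 0 := by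
  refine measure_null_of_locally_null _ fun q hq => ?_
  obtain ⟨r, hr, hball⟩ := Metric.eventually_nhds_iff_ball.1 (hf q hq.1).eventually_analyticAt
  obtain ⟨x, hfx, hx⟩ := ((hne q hq.1).and_eventually (Metric.ball_mem_nhds q hr)).exists
  refine ⟨Metric.ball q r ∩ f ⁻¹' {0}, ?_, addHaar_inter_zeros_eq_zero_of_convex μ
    Metric.isOpen_ball (convex_ball q r) hball hx hfx⟩
  filter_upwards [mem_nhdsWithin_of_mem_nhds (Metric.ball_mem_nhds q hr), self_mem_nhdsWithin]
    with y hy hys using ⟨hy, hys.2⟩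

theorem addHaar_inter_setOf_abs_eq_of_frequently_ne {g : E → ℝ} {s : Set E} {r : ℝ} (hr : 0 ≤ r)
    (hg : AnalyticOnNhd ℝ g s) (hne : ∀ q ∈ s, ∃ᶠ y in 𝓝 q, |g y| ≠ r) :
    μ (s ∩ {q | |g q| = r}) = 0 := by
  have hzero (q : E) : |g q| = r ↔ g q ^ 2 - r ^ 2 = 0 := by
    rw [sub_eq_zero, ← sq_abs (g q), sq_eq_sq₀ (abs_nonneg _) hr]
  have hsq : AnalyticOnNhd ℝ (fun q => g q ^ 2 - r ^ 2) s := (hg.pow 2).sub analyticOnNhd_const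
  simp only [hzero, ne_eq] at hne ⊢
  exact addHaar_inter_zeros_eq_zero_of_frequently_ne μ hsq hne

end AnalyticZeros

theorem exists_forall_add_mul_sub_le_of_convexOn {s : Set ℝ} {f : ℝ → ℝ} (hf : ConvexOn ℝ s f)
    {x : ℝ} (hx : x ∈ interior s) : ∃ ξ : ℝ, ∀ y ∈ s, f x + ξ * (y - x) ≤ f y := by
  refine ⟨derivWithin f (Set.Ioi x) x, fun y hy => ?_⟩
  rcases lt_trichotomy x y with hxy | rfl | hyx
  · have hslope := hf.rightDeriv_le_slope_of_mem_interior hx hy hxy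
    rw [slope_def_field, le_div_iff₀ (sub_pos.2 hxy)] at hslope
    linarith
  · simp
  · have hslope := (hf.slope_le_leftDeriv_of_mem_interior hy hx hyx).trans
      (hf.leftDeriv_le_rightDeriv_of_mem_interior hx)
    rw [slope_def_field, div_le_iff₀ (sub_pos.2 hyx)] at hslope
    linarith

section HardThreshold

/-- Hard thresholding at level `√(2γ)`, the operator that turns `ᾱ_d` into `α_d`. -/
noncomputable def hardThreshold (γ t : ℝ) : ℝ := if √(2 * γ) < |t| then t else 0

/-- The integrand `½ s² + γ 1[s ≠ 0] - s t` of the Lagrangian, at `s = α(z, w)` and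
`t = ᾱ_d(z, w; λ)`. -/
noncomputable def sparseCost (γ s t : ℝ) : ℝ :=
  1 / 2 * s ^ 2 + γ * {r : ℝ | r ≠ 0}.indicator (fun _ => 1) s - s * t

variable {γ s t : ℝ}

theorem abs_hardThreshold_le (γ t : ℝ) : |hardThreshold γ t| ≤ |t| := by
  unfold hardThreshold
  split_ifs <;> simp

theorem hardThreshold_of_nonpos (hγ : γ ≤ 0) (t : ℝ) : hardThreshold γ t = t := by
  simp [hardThreshold, Real.sqrt_eq_zero_of_nonpos (show 2 * γ ≤ 0 by linarith), eq_comm]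

theorem hardThreshold_of_sq_le (h : t ^ 2 ≤ 2 * γ) : hardThreshold γ t = 0 :=
  if_neg (Real.abs_le_sqrt h).not_gt

theorem hardThreshold_of_lt_sq (hγ : 0 ≤ γ) (h : 2 * γ < t ^ 2) : hardThreshold γ t = t :=
  if_pos ((Real.sqrt_lt (by positivity) (abs_nonneg t)).2 (by rwa [sq_abs]))

theorem measurable_hardThreshold (γ : ℝ) : Measurable (hardThreshold γ) :=
  Measurable.ite (measurableSet_lt measurable_const measurable_norm) measurable_id measurable_const

theorem continuousAt_hardThreshold (ht : 0 < γ → |t| ≠ √(2 * γ)) :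
    ContinuousAt (hardThreshold γ) t := by
  rcases le_or_gt γ 0 with hγ | hpos
  · exact continuousAt_id.congr (.of_forall fun s => (hardThreshold_of_nonpos hγ s).symm)
  rcases (ht hpos).lt_or_gt with hlt | hgt
  · refine continuousAt_const.congr (f := fun _ => 0) ?_
    filter_upwards [continuous_abs.continuousAt.eventually_lt_const hlt] with s hs
    exact (if_neg hs.not_gt).symm
  · refine continuousAt_id.congr ?_
    filter_upwards [continuous_abs.continuousAt.eventually_const_lt hgt] with s hs
    exact (if_pos hs).symm

theorem sparseCost_zero (γ t : ℝ) : sparseCost γ 0 t = 0 := by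
  simp [sparseCost]

theorem sparseCost_of_ne_zero (γ t : ℝ) (hs : s ≠ 0) :
    sparseCost γ s t = (s - t) ^ 2 / 2 + (γ - t ^ 2 / 2) := by
  rw [sparseCost, Set.indicator_of_mem hs]
  ring

theorem sparseCost_hardThreshold (hγ : 0 ≤ γ) (t : ℝ) :
    sparseCost γ (hardThreshold γ t) t = min 0 (γ - t ^ 2 / 2) := by
  rcases le_or_gt (t ^ 2) (2 * γ) with hle | hlt
  · rw [hardThreshold_of_sq_le hle, sparseCost_zero, min_eq_left (by linarith)]
  · have ht : t ≠ 0 := sq_pos_iff.1 (by linarith)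
    rw [hardThreshold_of_lt_sq hγ hlt, sparseCost_of_ne_zero γ t ht, min_eq_right (by linarith)]
    ring

theorem sparseCost_hardThreshold_le (hγ : 0 ≤ γ) (s t : ℝ) :
    sparseCost γ (hardThreshold γ t) t ≤ sparseCost γ s t := by
  rw [sparseCost_hardThreshold hγ]
  by_cases hs : s = 0
  · exact (min_le_left _ _).trans_eq (by rw [hs, sparseCost_zero])
  · rw [sparseCost_of_ne_zero γ t hs]
    exact (min_le_right _ _).trans (le_add_of_nonneg_left (by positivity))

theorem eq_hardThreshold_of_sparseCost_le (hγ : 0 ≤ γ) (ht : 0 < γ → |t| ≠ √(2 * γ))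
    (hle : sparseCost γ s t ≤ sparseCost γ (hardThreshold γ t) t) : s = hardThreshold γ t := by
  rw [sparseCost_hardThreshold hγ] at hle
  rcases le_or_gt (t ^ 2) (2 * γ) with hsq | hsq
  · rw [hardThreshold_of_sq_le hsq]
    by_contra hs
    rw [sparseCost_of_ne_zero γ t hs, min_eq_left (by linarith)] at hle
    have hst : s = t := by
      rw [← sub_eq_zero, ← sq_nonpos_iff]
      linarith
    have hpos : 0 < t ^ 2 := sq_pos_of_ne_zero (hst ▸ hs)
    have heq : 2 * γ = t ^ 2 := le_antisymm (by linarith [sq_nonneg (s - t)]) hsq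
    exact ht (by linarith) (by rw [heq, Real.sqrt_sq_eq_abs])
  · rw [hardThreshold_of_lt_sq hγ hsq]
    rw [min_eq_right (by linarith)] at hle
    have hs : s ≠ 0 := by
      rintro rfl
      rw [sparseCost_zero] at hle
      linarith
    rw [sparseCost_of_ne_zero γ t hs] at hle
    rw [← sub_eq_zero, ← sq_nonpos_iff]
    linarith

end HardThreshold

section Integral

variable {Ω : Type*} [MeasurableSpace Ω] {μ : Measure Ω} {γ : ℝ} {α f : Ω → ℝ}

theorem memLp_hardThreshold {r : ENNReal} (γ : ℝ) (hf : MemLp f r μ) :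
    MemLp (fun q => hardThreshold γ (f q)) r μ :=
  hf.mono ((measurable_hardThreshold γ).comp_aemeasurable hf.aemeasurable).aestronglyMeasurable
    (ae_of_all _ fun _ => abs_hardThreshold_le _ _)

theorem continuousAt_integral_hardThreshold_sum_mul {ι : Type*} [Fintype ι] {φ : ι → Ω → ℝ}
    {h : Ω → ℝ} (hφ : ∀ i, MemLp (φ i) 2 μ) (hh : MemLp h 2 μ) {l : ι → ℝ}
    (hlev : ∀ᵐ q ∂μ, 0 < γ → |∑ i, l i * φ i q| ≠ √(2 * γ)) :
    ContinuousAt (fun l : ι → ℝ => ∫ q, hardThreshold γ (∑ i, l i * φ i q) * h q ∂μ) l := by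
  have hsum (l : ι → ℝ) : MemLp (fun q => ∑ i, l i * φ i q) 2 μ :=
    memLp_finsetSum _ fun i _ => (hφ i).const_mul (l i)
  have hbound : ∀ᶠ l' in 𝓝 l, ∀ᵐ q ∂μ,
      ‖hardThreshold γ (∑ i, l' i * φ i q) * h q‖ ≤ (∑ i, (‖l‖ + 1) * |φ i q|) * |h q| := by
    filter_upwards [continuous_norm.continuousAt.eventually_lt_const (lt_add_one ‖l‖)] with l' hl'
    refine ae_of_all _ fun q => ?_
    rw [norm_mul, Real.norm_eq_abs, Real.norm_eq_abs]
    gcongr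
    calc |hardThreshold γ (∑ i, l' i * φ i q)|
        ≤ |∑ i, l' i * φ i q| := abs_hardThreshold_le _ _
      _ ≤ ∑ i, |l' i * φ i q| := Finset.abs_sum_le_sum_abs _ _
      _ ≤ ∑ i, (‖l‖ + 1) * |φ i q| := by
        gcongr with i
        rw [abs_mul]
        gcongr
        exact (norm_le_pi_norm l' i).trans hl'.le
  have hdom : Integrable (fun q => (∑ i, (‖l‖ + 1) * |φ i q|) * |h q|) μ :=
    MemLp.integrable_mul (memLp_finsetSum _ fun i _ => (hφ i).abs.const_mul _) hh.abs
  refine continuousAt_of_dominated (.of_forall fun l' => ?_) hbound hdom ?_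
  · exact ((memLp_hardThreshold γ (hsum l')).integrable_mul hh).aestronglyMeasurable
  · filter_upwards [hlev] with q hq
    refine ContinuousAt.mul_const ?_ _
    have hlin : Continuous fun l : ι → ℝ => ∑ i, l i * φ i q := by fun_prop
    exact (continuousAt_hardThreshold hq).comp_of_eq hlin.continuousAt rfl

variable [IsFiniteMeasure μ]

theorem integrable_indicator_ne_zero (hα : AEMeasurable α μ) :
    Integrable ({q | α q ≠ 0}.indicator fun _ => (1 : ℝ)) μ :=
  (integrable_const 1).indicator₀
    (hα.nullMeasurableSet_preimage (measurableSet_singleton (0 : ℝ)).compl)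

theorem integrable_sparseCost (γ : ℝ) (hα : MemLp α 2 μ) (hf : MemLp f 2 μ) :
    Integrable (fun q => sparseCost γ (α q) (f q)) μ :=
  ((hα.integrable_sq.const_mul _).add
    ((integrable_indicator_ne_zero hα.aemeasurable).const_mul _)).sub (hα.integrable_mul hf)

theorem integral_sparseCost (γ : ℝ) (hα : MemLp α 2 μ) (hf : MemLp f 2 μ) :
    ∫ q, sparseCost γ (α q) (f q) ∂μ = 1 / 2 * ∫ q, α q ^ 2 ∂μ
      + γ * ∫ q, {q | α q ≠ 0}.indicator (fun _ => (1 : ℝ)) q ∂μ - ∫ q, α q * f q ∂μ := by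
  have hsq := hα.integrable_sq.const_mul (1 / 2)
  have hind := (integrable_indicator_ne_zero hα.aemeasurable).const_mul γ
  simp only [sparseCost]
  rw [← integral_const_mul, ← integral_const_mul, ← integral_add hsq hind]
  exact integral_sub (hsq.add hind) (hα.integrable_mul hf)

theorem integral_sparseCost_hardThreshold_le (hγ : 0 ≤ γ) (hα : MemLp α 2 μ) (hf : MemLp f 2 μ) :
    ∫ q, sparseCost γ (hardThreshold γ (f q)) (f q) ∂μ ≤ ∫ q, sparseCost γ (α q) (f q) ∂μ :=
  integral_mono (integrable_sparseCost γ (memLp_hardThreshold γ hf) hf)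
    (integrable_sparseCost γ hα hf) fun _ => sparseCost_hardThreshold_le hγ _ _

theorem ae_eq_hardThreshold_of_integral_sparseCost_le (hγ : 0 ≤ γ) (hα : MemLp α 2 μ)
    (hf : MemLp f 2 μ) (hlev : ∀ᵐ q ∂μ, 0 < γ → |f q| ≠ √(2 * γ))
    (hle : ∫ q, sparseCost γ (α q) (f q) ∂μ
      ≤ ∫ q, sparseCost γ (hardThreshold γ (f q)) (f q) ∂μ) :
    α =ᵐ[μ] fun q => hardThreshold γ (f q) := by
  have hcost := (integral_eq_iff_of_ae_le
    (integrable_sparseCost γ (memLp_hardThreshold γ hf) hf) (integrable_sparseCost γ hα hf)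
    (ae_of_all _ fun _ => sparseCost_hardThreshold_le hγ _ _)).1
    (le_antisymm (integral_sparseCost_hardThreshold_le hγ hα hf) hle)
  filter_upwards [hcost, hlev] with q hq hl
  exact eq_hardThreshold_of_sparseCost_le hγ hl hq.ge

end Integral

namespace SparseProgram

variable {p N : ℕ} {P : SparseProgram p N} {α : EuclideanSpace ℝ (Fin p) × ℝ → ℝ}
  {l m : Fin N → ℝ}

theorem leb_setOf_abs_alphaBar_eq (han : ∀ i, AnalyticOnNhd ℝ (P.kAt i) (P.X ×ˢ P.W))
    {r : ℝ} (hr : 0 ≤ r) (hne : ∀ q ∈ P.X ×ˢ P.W, ∃ᶠ q' in 𝓝 q, |P.alphaBar l q'| ≠ r) :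
    P.leb {q | |P.alphaBar l q| = r} = 0 := by
  have : (volume : Measure (EuclideanSpace ℝ (Fin p) × ℝ)).IsAddHaarMeasure := by
    rw [Measure.volume_eq_prod]
    infer_instance
  have hbar : AnalyticOnNhd ℝ (P.alphaBar l) (P.X ×ˢ P.W) :=
    Finset.analyticOnNhd_fun_sum _ fun i _ => analyticOnNhd_const.mul (han i)
  rw [leb, Measure.restrict_apply' (P.isCompact_X.prod P.isCompact_W).measurableSet,
    Set.inter_comm]
  exact addHaar_inter_setOf_abs_eq_of_frequently_ne volume hr hbar hne

instance isFiniteMeasure_leb : IsFiniteMeasure P.leb :=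
  isFiniteMeasure_restrict.2 (P.isCompact_X.prod P.isCompact_W).measure_ne_top

theorem inL2_alphaBar (hL2 : ∀ i, P.InL2 (P.kAt i)) (l : Fin N → ℝ) : P.InL2 (P.alphaBar l) :=
  memLp_finsetSum _ fun i _ => (hL2 i).const_mul (l i)

theorem inL2_alphaD (hL2 : ∀ i, P.InL2 (P.kAt i)) (l : Fin N → ℝ) : P.InL2 (P.alphaD l) :=
  memLp_hardThreshold P.γ (inL2_alphaBar hL2 l)

theorem continuousAt_prediction_alphaD (hL2 : ∀ i, P.InL2 (P.kAt i))
    (hlev : ∀ᵐ q ∂P.leb, 0 < P.γ → |P.alphaBar l q| ≠ √(2 * P.γ)) (i : Fin N) :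
    ContinuousAt (fun l => P.prediction (P.alphaD l) i) l :=
  continuousAt_integral_hardThreshold_sum_mul hL2 (hL2 i) hlev

theorem integral_mul_alphaBar (hL2 : ∀ i, P.InL2 (P.kAt i)) (hα : P.InL2 α) (l : Fin N → ℝ) :
    ∫ q, α q * P.alphaBar l q ∂P.leb = ∑ i, l i * P.prediction α i := by
  simp only [alphaBar, Finset.mul_sum, prediction, ← integral_const_mul, mul_left_comm (α _)]
  exact integral_finsetSum _ fun i _ => (hα.integrable_mul (hL2 i)).const_mul (l i)

theorem lagrangian_eq_integral_sparseCost_add (hL2 : ∀ i, P.InL2 (P.kAt i)) (hα : P.InL2 α)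
    (yhat l m : Fin N → ℝ) :
    P.lagrangian α yhat l m = ∫ q, sparseCost P.γ (α q) (P.alphaBar l q) ∂P.leb
      + ∑ i, l i * yhat i + ∑ i, m i * P.c (yhat i) (P.y i) := by
  rw [integral_sparseCost P.γ hα (inL2_alphaBar hL2 l), integral_mul_alphaBar hL2 hα]
  rfl

theorem lagrangian_alphaD_le (hL2 : ∀ i, P.InL2 (P.kAt i)) (hα : P.InL2 α)
    (yhat l m : Fin N → ℝ) :
    P.lagrangian (P.alphaD l) yhat l m ≤ P.lagrangian α yhat l m := by
  rw [lagrangian_eq_integral_sparseCost_add hL2 hα,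
    lagrangian_eq_integral_sparseCost_add hL2 (inL2_alphaD hL2 l)]
  gcongr ?_ + _ + _
  exact integral_sparseCost_hardThreshold_le P.γ_nonneg hα (inL2_alphaBar hL2 l)

theorem ae_eq_alphaD_of_lagrangian_le (hL2 : ∀ i, P.InL2 (P.kAt i)) (hα : P.InL2 α)
    (hlev : ∀ᵐ q ∂P.leb, 0 < P.γ → |P.alphaBar l q| ≠ √(2 * P.γ)) {yhat : Fin N → ℝ}
    (hle : P.lagrangian α yhat l m ≤ P.lagrangian (P.alphaD l) yhat l m) :
    α =ᵐ[P.leb] P.alphaD l := by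
  rw [lagrangian_eq_integral_sparseCost_add hL2 hα,
    lagrangian_eq_integral_sparseCost_add hL2 (inL2_alphaD hL2 l), add_le_add_iff_right,
    add_le_add_iff_right] at hle
  exact ae_eq_hardThreshold_of_integral_sparseCost_le P.γ_nonneg hα (inL2_alphaBar hL2 l) hlev hle

theorem lagrangian_add (α : EuclideanSpace ℝ (Fin p) × ℝ → ℝ) (yhat l m d e : Fin N → ℝ) :
    P.lagrangian α yhat (l + d) (m + e) = P.lagrangian α yhat l m
      + ∑ i, d i * (yhat i - P.prediction α i) + ∑ i, e i * P.c (yhat i) (P.y i) := by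
  simp only [lagrangian, Pi.add_apply, add_mul, mul_sub, Finset.sum_add_distrib,
    Finset.sum_sub_distrib]
  ring

theorem lagrangian_add_smul (α : EuclideanSpace ℝ (Fin p) × ℝ → ℝ) (yhat l m d e : Fin N → ℝ)
    (ε : ℝ) :
    P.lagrangian α yhat (l + ε • d) (m + ε • e)
      = (1 - ε) * P.lagrangian α yhat l m + ε * P.lagrangian α yhat (l + d) (m + e) := by
  simp only [lagrangian_add, Pi.smul_apply, smul_eq_mul, mul_assoc, ← Finset.mul_sum]
  ring

theorem lagrangian_add_single (α : EuclideanSpace ℝ (Fin p) × ℝ → ℝ) (yhat l m : Fin N → ℝ)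
    (i : Fin N) (a b : ℝ) :
    P.lagrangian α yhat (l + Pi.single i a) (m + Pi.single i b) = P.lagrangian α yhat l m
      + a * (yhat i - P.prediction α i) + b * P.c (yhat i) (P.y i) := by
  simp [lagrangian_add, Pi.single_apply]

theorem lagrangian_zero_zero (α : EuclideanSpace ℝ (Fin p) × ℝ → ℝ) (yhat : Fin N → ℝ) :
    P.lagrangian α yhat 0 0 = P.objective α := by
  simp [lagrangian]

theorem lagrangian_prediction_le_objective (hα : P.IsFeasible α) (l : Fin N → ℝ)
    (hm : ∀ i, 0 ≤ m i) : P.lagrangian α (P.prediction α) l m ≤ P.objective α := by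
  have hsum : ∑ i, m i * P.c (P.prediction α i) (P.y i) ≤ 0 :=
    Finset.sum_nonpos fun i _ => mul_nonpos_of_nonneg_of_nonpos (hm i) (hα.2 i)
  rw [lagrangian, sub_add_cancel]
  linarith

theorem lagrangian_alphaD_add_sum_le (hL2 : ∀ i, P.InL2 (P.kAt i)) (hα : P.InL2 α)
    (yhat l m d e : Fin N → ℝ) :
    P.lagrangian (P.alphaD l) yhat (l + d) (m + e)
        + ∑ i, d i * (P.prediction (P.alphaD l) i - P.prediction α i)
      ≤ P.lagrangian α yhat (l + d) (m + e) := by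
  have hmin := lagrangian_alphaD_le hL2 hα yhat l m
  simp only [lagrangian_add, mul_sub, Finset.sum_sub_distrib]
  linarith

theorem dualFunction_le_lagrangian (hα : P.InL2 α) (yhat l m : Fin N → ℝ) :
    P.dualFunction l m ≤ P.lagrangian α yhat l m :=
  iInf₂_le (f := fun (α : {f // P.InL2 f}) yhat => (P.lagrangian α.1 yhat l m : EReal)) ⟨α, hα⟩ yhat

theorem le_dualFunction (hL2 : ∀ i, P.InL2 (P.kAt i)) {B : ℝ}
    (hB : ∀ yhat, B ≤ P.lagrangian (P.alphaD l) yhat l m) : (B : EReal) ≤ P.dualFunction l m :=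
  le_iInf₂ fun α yhat =>
    EReal.coe_le_coe_iff.2 ((hB yhat).trans (lagrangian_alphaD_le hL2 α.2 yhat l m))

theorem dualFunction_le_objective (hα : P.IsFeasible α) (l : Fin N → ℝ) (hm : ∀ i, 0 ≤ m i) :
    P.dualFunction l m ≤ P.objective α :=
  (dualFunction_le_lagrangian hα.1 _ l m).trans
    (EReal.coe_le_coe_iff.2 (lagrangian_prediction_le_objective hα l hm))

theorem objective_nonneg (α : EuclideanSpace ℝ (Fin p) × ℝ → ℝ) : 0 ≤ P.objective α := by
  have hsq : 0 ≤ P.sqNormL2 α := integral_nonneg fun _ => sq_nonneg _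
  have hsupp : 0 ≤ P.normL0 α :=
    integral_nonneg fun q => Set.indicator_nonneg (fun _ _ => zero_le_one) q
  have := P.γ_nonneg
  unfold objective
  positivity

namespace IsDualSolution

theorem exists_dualFunction_eq_coe (h : P.IsDualSolution l m) :
    ∃ T : ℝ, P.dualFunction l m = T := by
  have hzero : (0 : EReal) ≤ P.dualFunction 0 0 := le_iInf₂ fun α yhat => by
    rw [lagrangian_zero_zero]
    exact EReal.coe_nonneg.2 (objective_nonneg α.1)
  have hbot : P.dualFunction l m ≠ ⊥ :=
    ne_bot_of_le_ne_bot EReal.zero_ne_bot (hzero.trans (h.2 0 0 fun _ => le_rfl))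
  have htop : P.dualFunction l m ≠ ⊤ :=
    ne_top_of_le_ne_top (EReal.coe_ne_top _) (dualFunction_le_lagrangian (α := 0) MemLp.zero 0 l m)
  exact ⟨_, (EReal.coe_toReal htop hbot).symm⟩

theorem add_sum_prediction_sub_le (h : P.IsDualSolution l m) (hL2 : ∀ i, P.InL2 (P.kAt i))
    {T : ℝ} (hT : P.dualFunction l m = T) {d e : Fin N → ℝ} (he : ∀ i, 0 ≤ m i + e i) {B : ℝ}
    (hB : ∀ yhat, B ≤ P.lagrangian (P.alphaD l) yhat (l + d) (m + e))
    {ε : ℝ} (hε : ε ∈ Set.Ioo 0 1) :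
    B + ∑ i, d i * (P.prediction (P.alphaD l) i - P.prediction (P.alphaD (l + ε • d)) i) ≤ T := by
  set δ := ∑ i, d i * (P.prediction (P.alphaD l) i - P.prediction (P.alphaD (l + ε • d)) i)
  have hε' : 0 < 1 - ε := sub_pos.2 hε.2
  have hαε := inL2_alphaD hL2 (l + ε • d)
  have hpos (i : Fin N) : 0 ≤ (m + ε • e) i := by
    have hcomb : (m + ε • e) i = (1 - ε) * m i + ε * (m i + e i) := by
      simp only [Pi.add_apply, Pi.smul_apply, smul_eq_mul]
      ring
    rw [hcomb]
    exact add_nonneg (mul_nonneg hε'.le (h.1 i)) (mul_nonneg hε.1.le (he i))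
  have hlower (yhat : Fin N → ℝ) : (1 - ε) * T + ε * (B + δ)
      ≤ P.lagrangian (P.alphaD (l + ε • d)) yhat (l + ε • d) (m + ε • e) := by
    have hTle : T ≤ P.lagrangian (P.alphaD (l + ε • d)) yhat l m :=
      EReal.coe_le_coe_iff.1 (hT ▸ dualFunction_le_lagrangian hαε yhat l m)
    have hBle : B + δ ≤ P.lagrangian (P.alphaD (l + ε • d)) yhat (l + d) (m + e) :=
      (add_le_add_left (hB yhat) δ).trans (lagrangian_alphaD_add_sum_le hL2 hαε yhat l m d e)
    rw [lagrangian_add_smul]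
    exact add_le_add (mul_le_mul_of_nonneg_left hTle hε'.le)
      (mul_le_mul_of_nonneg_left hBle hε.1.le)
  have hopt : (1 - ε) * T + ε * (B + δ) ≤ T :=
    EReal.coe_le_coe_iff.1 (hT ▸ (le_dualFunction hL2 hlower).trans (h.2 _ _ hpos))
  exact le_of_mul_le_mul_left (by linarith) hε.1

theorem le_dualFunction_of_forall_le_lagrangian (h : P.IsDualSolution l m)
    (hL2 : ∀ i, P.InL2 (P.kAt i))
    (hlev : ∀ᵐ q ∂P.leb, 0 < P.γ → |P.alphaBar l q| ≠ √(2 * P.γ))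
    {d e : Fin N → ℝ} (he : ∀ i, 0 ≤ m i + e i) {B : ℝ}
    (hB : ∀ yhat, B ≤ P.lagrangian (P.alphaD l) yhat (l + d) (m + e)) :
    (B : EReal) ≤ P.dualFunction l m := by
  obtain ⟨T, hT⟩ := h.exists_dualFunction_eq_coe
  rw [hT, EReal.coe_le_coe_iff]
  have hcont : ContinuousAt (fun l' => B + ∑ i, d i *
      (P.prediction (P.alphaD l) i - P.prediction (P.alphaD l') i)) l := by
    have := continuousAt_prediction_alphaD hL2 hlev
    fun_prop
  have hline : Tendsto (fun ε : ℝ => l + ε • d) (𝓝[>] 0) (𝓝 l) :=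
    tendsto_nhdsWithin_of_tendsto_nhds (Continuous.tendsto' (by fun_prop) _ _ (by simp))
  have hlim := hcont.tendsto.comp hline
  simp only [sub_self, mul_zero, Finset.sum_const_zero, add_zero] at hlim
  refine le_of_tendsto hlim ?_
  filter_upwards [Ioo_mem_nhdsGT one_pos] with ε hε
  exact h.add_sum_prediction_sub_le hL2 hT he hB hε

theorem isFeasible_alphaD (h : P.IsDualSolution l m) (hL2 : ∀ i, P.InL2 (P.kAt i))
    (hlev : ∀ᵐ q ∂P.leb, 0 < P.γ → |P.alphaBar l q| ≠ √(2 * P.γ)) :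
    P.IsFeasible (P.alphaD l) := by
  obtain ⟨T, hT⟩ := h.exists_dualFunction_eq_coe
  refine ⟨inL2_alphaD hL2 l, fun i => ?_⟩
  set s := P.prediction (P.alphaD l) i with hs
  obtain ⟨ξ, hξ⟩ := exists_forall_add_mul_sub_le_of_convexOn (P.convex_c (P.y i)) (x := s) (by simp)
  have hsingle : (0 : Fin N → ℝ) ≤ Pi.single i 1 := Pi.single_nonneg.2 zero_le_one
  have hB (yhat : Fin N → ℝ) : T + P.c s (P.y i)
      ≤ P.lagrangian (P.alphaD l) yhat (l + Pi.single i (-ξ)) (m + Pi.single i 1) := by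
    have hTle : T ≤ P.lagrangian (P.alphaD l) yhat l m :=
      EReal.coe_le_coe_iff.1 (hT ▸ dualFunction_le_lagrangian (inL2_alphaD hL2 l) yhat l m)
    rw [lagrangian_add_single, ← hs]
    linarith [hξ (yhat i) (Set.mem_univ _)]
  have hle := h.le_dualFunction_of_forall_le_lagrangian hL2 hlev
    (fun j => add_nonneg (h.1 j) (hsingle j)) hB
  rw [hT, EReal.coe_le_coe_iff] at hle
  linarith

theorem objective_alphaD_le_dualFunction (h : P.IsDualSolution l m)
    (hL2 : ∀ i, P.InL2 (P.kAt i))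
    (hlev : ∀ᵐ q ∂P.leb, 0 < P.γ → |P.alphaBar l q| ≠ √(2 * P.γ)) :
    (P.objective (P.alphaD l) : EReal) ≤ P.dualFunction l m :=
  h.le_dualFunction_of_forall_le_lagrangian hL2 hlev (d := -l) (e := -m) (by simp) fun yhat => by
    rw [add_neg_cancel, add_neg_cancel, lagrangian_zero_zero]

theorem isPrimalSolution_alphaD (h : P.IsDualSolution l m) (hL2 : ∀ i, P.InL2 (P.kAt i))
    (hlev : ∀ᵐ q ∂P.leb, 0 < P.γ → |P.alphaBar l q| ≠ √(2 * P.γ)) :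
    P.IsPrimalSolution (P.alphaD l) :=
  ⟨h.isFeasible_alphaD hL2 hlev, fun _ hβ => EReal.coe_le_coe_iff.1
    ((h.objective_alphaD_le_dualFunction hL2 hlev).trans (dualFunction_le_objective hβ l h.1))⟩

theorem ae_eq_alphaD (h : P.IsDualSolution l m) (hL2 : ∀ i, P.InL2 (P.kAt i))
    (hlev : ∀ᵐ q ∂P.leb, 0 < P.γ → |P.alphaBar l q| ≠ √(2 * P.γ))
    (hα : P.IsPrimalSolution α) : α =ᵐ[P.leb] P.alphaD l := by
  refine ae_eq_alphaD_of_lagrangian_le (m := m) (yhat := P.prediction α) hL2 hα.1.1 hlev ?_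
  calc P.lagrangian α (P.prediction α) l m
      ≤ P.objective α := lagrangian_prediction_le_objective hα.1 l h.1
    _ ≤ P.objective (P.alphaD l) := hα.2 _ (h.isFeasible_alphaD hL2 hlev)
    _ ≤ P.lagrangian (P.alphaD l) (P.prediction α) l m :=
      EReal.coe_le_coe_iff.1 ((h.objective_alphaD_le_dualFunction hL2 hlev).trans
        (dualFunction_le_lagrangian (inL2_alphaD hL2 l) _ l m))

end IsDualSolution

end SparseProgram

/-- `hnd` says that, for `γ > 0`, the analytic function `ᾱ_d² - 2γ` does not vanish identically
near any point of `X × W`; without it the claim fails already for a constant kernel. -/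
theorem corollary1 {p N : ℕ} (P : SparseProgram p N)
    (hL2 : ∀ i, P.InL2 (P.kAt i))
    (han : ∀ i, AnalyticOnNhd ℝ (P.kAt i) (P.X ×ˢ P.W))
    (lstar mstar : Fin N → ℝ) (hdual : P.IsDualSolution lstar mstar)
    (hnd : 0 < P.γ → ∀ q ∈ P.X ×ˢ P.W, ∃ᶠ q' in 𝓝 q, |P.alphaBar lstar q'| ≠ √(2 * P.γ)) :
    P.IsPrimalSolution (P.alphaD lstar) ∧
    (∀ α, P.IsPrimalSolution α → α =ᵐ[P.leb] P.alphaD lstar) ∧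
    (0 < P.γ → P.leb {q | |P.alphaBar lstar q| = √(2 * P.γ)} = 0) := by
  have hnull : 0 < P.γ → P.leb {q | |P.alphaBar lstar q| = √(2 * P.γ)} = 0 := fun hγ =>
    SparseProgram.leb_setOf_abs_alphaBar_eq han (Real.sqrt_nonneg _) (hnd hγ)
  have hlev : ∀ᵐ q ∂P.leb, 0 < P.γ → |P.alphaBar lstar q| ≠ √(2 * P.γ) :=
    eventually_imp_distrib_left.2 fun hγ => measure_eq_zero_iff_ae_notMem.1 (hnull hγ)
  exact ⟨hdual.isPrimalSolution_alphaD hL2 hlev, fun _ hα => hdual.ae_eq_alphaD hL2 hlev hα, hnull⟩
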